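/- Let $\alpha$ be an ordinal. A group $G$ is *$\alpha$-residually finite* if there are subgroups $\{G_\beta\}_{\beta\le\alpha}$ of $G$ with $G_0=G$ and $G_\alpha=\{1\}$, with $G_\gamma\le G_\beta$ whenever $\beta<\gamma\le\alpha$, with $[G_\beta:G_{\beta+1}]$ finite for all $\beta<\alpha$, and with $G_\lambda=\bigcap_{\beta<\lambda}G_\beta$ for every limit ordinal $\lambda\le\alpha$. If such an $\alpha$ exists, the *residual finiteness depth* of $G$ is the least ordinal $\alpha$ for which $G$ is $\alpha$-residually finite. **Corollary C.** There are uncountably many ordinals that arise as the residual finiteness depth of a finitely generated group but not as the residual finiteness depth of a finitely presented group. -/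

import Mathlib

universe u v

/-- A group `G` is `α`-residually finite if there is a decreasing chain of subgroups
`G_β`, `β ≤ α`, from `G` to the trivial subgroup, such that each `G_(β+1)` has finite index in
`G_β` and intersections are taken at limit ordinals. The chain is given by a function on all
ordinals, of which only the values at ordinals `β ≤ α` are constrained. -/
def IsOrdinalResiduallyFinite (G : Type u) [Group G] (α : Ordinal.{v}) : Prop :=
  ∃ H : Ordinal.{v} → Subgroup G,
    H 0 = ⊤ ∧ H α = ⊥ ∧
    (∀ β γ, β < γ → γ ≤ α → H γ ≤ H β) ∧
    (∀ β, β < α → ((H (β + 1)).subgroupOf (H β)).FiniteIndex) ∧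
    (∀ l, Order.IsSuccLimit l → l ≤ α → H l = ⨅ β : Set.Iio l, H β)

/-- The residual finiteness depth of `G` is defined and equal to `α`: `α` is the least ordinal
for which `G` is `α`-residually finite. (Some groups have no depth.) -/
def HasRFDepth (G : Type u) [Group G] (α : Ordinal.{v}) : Prop :=
  IsLeast {β : Ordinal.{v} | IsOrdinalResiduallyFinite G β} α

open Function

namespace RFDepth

/-! ### Chains of subgroups -/

/-! Up to isomorphism there are countably many finite presentations, and isomorphic groups have the
same depth, so finitely presented groups realise only countably many depths. It remains to see that
finitely generated groups realise uncountably many, and for this that every countable ordinal lies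
below such a depth. A countable reduced group has a depth, and that depth is countable. By
transfinite induction, each countable `α` admits a countable reduced abelian group with an element
`z ≠ 1` lying in all terms up to `α` of every chain (`exists_isDeep`), which forces depth above `α`.
Deep elements stay deep under homomorphisms, and wreath products with `ℤ` embed the group in a
2-generated reduced one (`exists_fg_embedding`). -/

/-- `H` is a decreasing chain of subgroups up to `α`, starting with the whole group, with finite
index at successors and intersections at limits. -/
def IsFiniteIndexChain {G : Type*} [Group G] (H : Ordinal.{v} → Subgroup G) (α : Ordinal.{v}) :
    Prop :=
  H 0 = ⊤ ∧ (∀ β γ, β < γ → γ ≤ α → H γ ≤ H β) ∧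
    (∀ β, β < α → (H (β + 1)).relIndex (H β) ≠ 0) ∧
    (∀ l, Order.IsSuccLimit l → l ≤ α → H l = ⨅ β : Set.Iio l, H β)

theorem isOrdinalResiduallyFinite_iff {G : Type u} [Group G] {α : Ordinal.{v}} :
    IsOrdinalResiduallyFinite G α ↔
      ∃ H : Ordinal.{v} → Subgroup G, IsFiniteIndexChain H α ∧ H α = ⊥ := by
  simp only [IsOrdinalResiduallyFinite, IsFiniteIndexChain, Subgroup.finiteIndex_iff,
    Subgroup.relIndex]
  exact exists_congr fun H ↦ by tauto

theorem IsFiniteIndexChain.mono {G : Type*} [Group G] {H : Ordinal.{v} → Subgroup G}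
    {α β : Ordinal.{v}} (h : IsFiniteIndexChain H α) (hβ : β ≤ α) : IsFiniteIndexChain H β :=
  ⟨h.1, fun γ δ h₁ h₂ ↦ h.2.1 γ δ h₁ (h₂.trans hβ), fun γ hγ ↦ h.2.2.1 γ (hγ.trans_le hβ),
    fun l hl hlβ ↦ h.2.2.2 l hl (hlβ.trans hβ)⟩

theorem IsFiniteIndexChain.comap {G G' : Type*} [Group G] [Group G']
    {H : Ordinal.{v} → Subgroup G'} {α : Ordinal.{v}} (h : IsFiniteIndexChain H α) (f : G →* G') :
    IsFiniteIndexChain (fun β ↦ (H β).comap f) α := by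
  refine ⟨by simp [h.1], fun β γ h₁ h₂ ↦ Subgroup.comap_mono (h.2.1 β γ h₁ h₂),
    fun β hβ ↦ Subgroup.relIndex_comap_ne_zero f (h.2.2.1 β hβ), fun l hl hlα ↦ ?_⟩
  simp only [h.2.2.2 l hl hlα, Subgroup.comap_iInf]

/-- An element lying in every term with index at most `α` of every chain. -/
def IsDeep {G : Type*} [Group G] (z : G) (α : Ordinal.{v}) : Prop :=
  ∀ β ≤ α, ∀ H : Ordinal.{v} → Subgroup G, IsFiniteIndexChain H β → z ∈ H β

theorem IsDeep.map {G G' : Type*} [Group G] [Group G'] {z : G} {α : Ordinal.{v}}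
    (h : IsDeep z α) (f : G →* G') : IsDeep (f z) α :=
  fun β hβ _ hH ↦ h β hβ _ (hH.comap f)

theorem lt_of_hasRFDepth_of_isDeep {G : Type*} [Group G] {z : G} {α δ : Ordinal.{v}}
    (h : IsDeep z α) (hz : z ≠ 1) (hδ : HasRFDepth G δ) : α < δ := by
  by_contra! hle
  obtain ⟨H, hH, hbot⟩ := isOrdinalResiduallyFinite_iff.1 hδ.1
  have := h δ hle H hH
  rw [hbot, Subgroup.mem_bot] at this
  exact hz this

/-- If `z` lies in `H γ`, some positive power of it with exponent at most the index `n` lies in `H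
(γ + 1)`. Terms need not be normal, so `n` itself may fail, but `n!` always works. -/
theorem isDeep_of_forall_pow {G : Type*} [Group G] {w : G} {α : Ordinal.{v}}
    (h : ∀ β < α, ∀ n : ℕ, n ≠ 0 → ∃ z : G, IsDeep z β ∧ z ^ n = w) : IsDeep w α := by
  intro β hβ H hH
  have key : ∀ γ < β, w ∈ H (γ + 1) := by
    intro γ hγ
    set n := (H (γ + 1)).relIndex (H γ) with hn
    obtain ⟨z, hz, hzw⟩ := h γ (hγ.trans_le hβ) n.factorial n.factorial_ne_zero
    rw [← hzw]
    refine (Subgroup.mem_inf.1 (Subgroup.pow_mem_of_relIndex_ne_zero_of_dvd (hH.2.2.1 γ hγ)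
      (hz γ le_rfl H (hH.mono hγ.le)) ?_)).1
    intro m h0 hm
    exact Nat.dvd_factorial h0 hm
  rcases Ordinal.zero_or_succ_or_isSuccLimit β with rfl | ⟨γ, rfl⟩ | hl
  · rw [hH.1]; trivial
  · exact key γ (Order.lt_succ γ)
  · rw [hH.2.2.2 β hl le_rfl, Subgroup.mem_iInf]
    rintro ⟨γ, hγ⟩
    exact hH.2.1 γ (γ + 1) (Order.lt_succ γ) (Order.succ_le_of_lt hγ) (key γ hγ)

/-! ### Reduced groups -/

/-- Every nontrivial subgroup has a proper subgroup of finite index. For abelian groups this means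
that the group has no nontrivial divisible subgroup. -/
def IsReducedGroup (G : Type*) [Group G] : Prop :=
  ∀ K : Subgroup G, K ≠ ⊥ → ∃ L : Subgroup K, L ≠ ⊤ ∧ L.index ≠ 0

theorem IsReducedGroup.exists_of_hom {G K : Type*} [Group G] [Group K] (h : IsReducedGroup G)
    (f : K →* G) (hf : f ≠ 1) : ∃ L : Subgroup K, L ≠ ⊤ ∧ L.index ≠ 0 := by
  obtain ⟨L, hL, hi⟩ := h f.range (by rwa [Ne, MonoidHom.range_eq_bot_iff])
  have hs := f.rangeRestrict_surjective
  refine ⟨L.comap f.rangeRestrict, fun h ↦ hL ?_, ?_⟩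
  · rw [← Subgroup.comap_top f.rangeRestrict] at h
    exact Subgroup.comap_injective hs h
  · rwa [Subgroup.index_comap_of_surjective _ hs]

theorem isReducedGroup_of_forall_hom {G : Type*} [Group G]
    (h : ∀ K : Subgroup G, K ≠ ⊥ → Finite K ∨
      ∃ (G' : Type*) (_ : Group G') (f : K →* G'), IsReducedGroup G' ∧ f ≠ 1) :
    IsReducedGroup G := by
  intro K hK
  obtain hfin | ⟨G', _, f, hG', hf⟩ := h K hK
  · refine ⟨⊥, fun h ↦ hK ?_, Subgroup.index_ne_zero_of_finite⟩
    refine (Subgroup.eq_bot_iff_forall K).2 fun x hx ↦ ?_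
    have hx' : (⟨x, hx⟩ : K) ∈ (⊥ : Subgroup K) := h ▸ Subgroup.mem_top _
    exact congrArg Subtype.val (Subgroup.mem_bot.1 hx')
  · exact hG'.exists_of_hom f hf

theorem IsReducedGroup.of_injective {G G' : Type*} [Group G] [Group G'] (h : IsReducedGroup G')
    (f : G →* G') (hf : Injective f) : IsReducedGroup G := by
  refine isReducedGroup_of_forall_hom fun K hK ↦ .inr ⟨G', _, f.comp K.subtype, h, fun h1 ↦ hK ?_⟩
  refine (Subgroup.eq_bot_iff_forall K).2 fun x hx ↦ hf ?_
  simpa using DFunLike.congr_fun h1 ⟨x, hx⟩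

theorem IsReducedGroup.of_hom_of_ker {G G' : Type*} [Group G] [Group G'] (h : IsReducedGroup G')
    (f : G →* G') (hf : IsReducedGroup f.ker) : IsReducedGroup G := by
  intro K hK
  by_cases hc : f.comp K.subtype = 1
  · have hle : K ≤ f.ker := fun x hx ↦ by simpa using DFunLike.congr_fun hc ⟨x, hx⟩
    refine hf.exists_of_hom (Subgroup.inclusion hle) fun h1 ↦ hK ?_
    refine (Subgroup.eq_bot_iff_forall K).2 fun x hx ↦ ?_
    simpa [Subtype.ext_iff] using DFunLike.congr_fun h1 ⟨x, hx⟩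
  · exact h.exists_of_hom _ hc

theorem isReducedGroup_of_finite {G : Type*} [Group G] [Finite G] : IsReducedGroup G :=
  isReducedGroup_of_forall_hom.{_, 0} fun _ _ ↦ .inl inferInstance

theorem isReducedGroup_multiplicative_int : IsReducedGroup (Multiplicative ℤ) := by
  refine isReducedGroup_of_forall_hom.{_, 0} fun K hK ↦ ?_
  obtain ⟨⟨x, hx⟩, hx1⟩ := Subgroup.ne_bot_iff_exists_ne_one.1 hK
  let a : ℤ := Multiplicative.toAdd x
  have ha0 : a ≠ 0 := fun h ↦ hx1 (Subtype.ext (Multiplicative.toAdd.injective h))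
  -- A modulus exceeding `|a|` cannot divide `a ≠ 0`.
  let m : ℕ := a.natAbs + 1
  have : NeZero m := ⟨by omega⟩
  refine .inr ⟨Multiplicative (ZMod m), inferInstance,
    (AddMonoidHom.toMultiplicative (Int.castAddHom (ZMod m))).comp K.subtype,
    isReducedGroup_of_finite, fun h1 ↦ ?_⟩
  have h2 := DFunLike.congr_fun h1 ⟨x, hx⟩
  have h3 : ((a : ℤ) : ZMod m) = 0 := congrArg Multiplicative.toAdd h2
  rw [ZMod.intCast_zmod_eq_zero_iff_dvd] at h3
  have h4 := Nat.le_of_dvd (Int.natAbs_pos.2 ha0) (Int.natCast_dvd.1 h3)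
  exact absurd h4 (Nat.lt_irrefl _)

/-- The first term of the chain not containing `K` has successor index, so it cuts `K` in a proper
subgroup of finite index. -/
theorem isReducedGroup_of_isOrdinalResiduallyFinite {G : Type u} [Group G] {α : Ordinal.{v}}
    (h : IsOrdinalResiduallyFinite G α) : IsReducedGroup G := by
  obtain ⟨H, hH, hbot⟩ := isOrdinalResiduallyFinite_iff.1 h
  intro K hK
  have hex : ∃ β, β ≤ α ∧ ¬ K ≤ H β := ⟨α, le_rfl, by rwa [hbot, le_bot_iff]⟩
  obtain ⟨β, ⟨hβ, hKβ⟩, hmin⟩ := WellFounded.has_min (r := (· < · : Ordinal → Ordinal → Prop))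
    Ordinal.lt_wf {β | β ≤ α ∧ ¬ K ≤ H β} hex
  have hlt : ∀ γ < β, K ≤ H γ := fun γ hγ ↦ by
    by_contra hc
    exact hmin γ ⟨hγ.le.trans hβ, hc⟩ hγ
  rcases Ordinal.zero_or_succ_or_isSuccLimit β with rfl | ⟨γ, rfl⟩ | hl
  · exact absurd (by simp [hH.1]) hKβ
  · refine ⟨(H (γ + 1)).subgroupOf K, fun h ↦ hKβ (Subgroup.subgroupOf_eq_top.1 h), ?_⟩
    exact fun h0 ↦ hH.2.2.1 γ ((Order.lt_succ γ).trans_le hβ)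
      (Subgroup.relIndex_eq_zero_of_le_right (hlt γ (Order.lt_succ γ)) h0)
  · refine absurd ?_ hKβ
    rw [hH.2.2.2 β hl hβ]
    exact le_iInf fun γ ↦ hlt γ γ.2

/-- Keep passing to proper finite-index subgroups. Each strict descent loses an element of `G`, and
these elements are distinct, so the trivial group is reached after countably many steps. -/
theorem exists_countable_isOrdinalResiduallyFinite {G : Type u} [Group G] [Countable G]
    (h : IsReducedGroup G) :
    ∃ α : Ordinal.{v}, (Set.Iio α).Countable ∧ IsOrdinalResiduallyFinite G α := by
  have hnext : ∀ K : Subgroup G, ∃ L ≤ K, L.relIndex K ≠ 0 ∧ (K ≠ ⊥ → L < K) := by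
    intro K
    by_cases hK : K = ⊥
    · exact ⟨K, le_rfl, by simp, fun h ↦ absurd hK h⟩
    · obtain ⟨L, hL, hi⟩ := h K hK
      have hle := Subgroup.map_subtype_le L
      refine ⟨L.map K.subtype, hle, ?_, fun _ ↦ lt_of_le_of_ne hle fun he ↦ hL ?_⟩
      · rwa [Subgroup.relIndex, Subgroup.subgroupOf,
          Subgroup.comap_map_eq_self_of_injective K.subtype_injective]
      · have := congrArg (Subgroup.comap K.subtype) he
        rw [Subgroup.comap_map_eq_self_of_injective K.subtype_injective] at this
        rw [this]
        exact Subgroup.subgroupOf_self K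
  choose next hle hidx hlt using hnext
  let H : Ordinal.{v} → Subgroup G :=
    WellFoundedLT.fix fun β (H : ∀ γ, γ < β → Subgroup G) ↦ ⨅ γ : Set.Iio β, next (H γ γ.2)
  have hH : ∀ β, H β = ⨅ γ : Set.Iio β, next (H γ) := fun β ↦ WellFoundedLT.fix_eq _ β
  have hnext : ∀ β γ, β < γ → H γ ≤ next (H β) := fun β γ hβ ↦ by
    rw [hH γ]
    exact iInf_le (fun δ : Set.Iio γ ↦ next (H δ)) ⟨β, hβ⟩
  have hanti : ∀ β γ, β < γ → H γ ≤ H β := fun β γ hβ ↦ (hnext β γ hβ).trans (hle _)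
  have hsucc : ∀ β, H (β + 1) = next (H β) := fun β ↦ by
    refine le_antisymm (hnext β _ (Order.lt_succ β)) ?_
    rw [hH (β + 1)]
    refine le_iInf fun ⟨γ, hγ⟩ ↦ ?_
    rcases (Order.lt_succ_iff.1 (Set.mem_Iio.1 hγ)).eq_or_lt with rfl | hγ
    · exact le_rfl
    · exact (hle _).trans (hnext γ β hγ)
  have hlim : ∀ l, Order.IsSuccLimit l → H l = ⨅ β : Set.Iio l, H β := fun l hl ↦ by
    refine le_antisymm (le_iInf fun β ↦ hanti β l β.2) ?_
    rw [hH l]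
    refine le_iInf fun ⟨β, hβ⟩ ↦ ?_
    rw [← hsucc β]
    exact iInf_le (fun γ : Set.Iio l ↦ H γ) ⟨β + 1, hl.succ_lt hβ⟩
  have hchain : ∀ α, IsFiniteIndexChain H α := fun α ↦
    ⟨by rw [hH 0]; simp, fun β γ hβ _ ↦ hanti β γ hβ,
      fun β _ ↦ by rw [hsucc]; exact hidx _, fun l hl _ ↦ hlim l hl⟩
  have hinj : ∀ s : Set Ordinal.{v}, (∀ β ∈ s, H β ≠ ⊥) → s.Countable := by
    intro s hs
    have hg : ∀ β : s, ∃ g : G, g ∈ H β ∧ g ∉ H (β + 1) := fun β ↦ by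
      rw [hsucc]
      exact SetLike.exists_of_lt (hlt _ (hs β β.2)) |>.imp fun g hg ↦ ⟨hg.1, hg.2⟩
    choose g hg hg' using hg
    have hne : ∀ β γ : s, β < γ → g β ≠ g γ := fun β γ hβ he ↦ by
      have : H γ ≤ H (β + 1) := by
        rw [hsucc]
        exact hnext _ _ hβ
      exact hg' β (this (he ▸ hg γ))
    have : Injective g := fun β γ he ↦ by
      rcases lt_trichotomy β γ with hl | hl | hl
      · exact absurd he (hne _ _ hl)
      · exact hl
      · exact absurd he.symm (hne _ _ hl)
    exact Set.countable_coe_iff.1 this.countable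
  have hex : ∃ α, H α = ⊥ := by
    by_contra! hc
    have hcount := Set.countable_univ_iff.1 (hinj Set.univ fun β _ ↦ hc β)
    obtain ⟨f, hf⟩ := exists_injective_nat Ordinal.{v}
    exact not_injective_of_ordinal f hf
  obtain ⟨α, hα, hmin⟩ := WellFounded.has_min (r := (· < · : Ordinal → Ordinal → Prop))
    Ordinal.lt_wf {α | H α = ⊥} hex
  exact ⟨α, hinj _ fun β hβ h0 ↦ hmin β h0 hβ,
    isOrdinalResiduallyFinite_iff.2 ⟨H, hchain α, hα⟩⟩

theorem exists_hasRFDepth {G : Type u} [Group G] [Countable G] (h : IsReducedGroup G) :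
    ∃ α : Ordinal.{v}, HasRFDepth G α := by
  obtain ⟨α, -, hα⟩ := exists_countable_isOrdinalResiduallyFinite.{u, v} h
  exact ⟨_, csInf_mem (s := {β : Ordinal.{v} | IsOrdinalResiduallyFinite G β}) ⟨α, hα⟩,
    fun _ hβ ↦ csInf_le' hβ⟩

theorem countable_Iio_of_hasRFDepth {G : Type u} [Group G] [Countable G] {α : Ordinal.{v}}
    (h : HasRFDepth G α) : (Set.Iio α).Countable := by
  obtain ⟨β, hβ, hβ'⟩ := exists_countable_isOrdinalResiduallyFinite.{u, v}
    (isReducedGroup_of_isOrdinalResiduallyFinite h.1)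
  exact hβ.mono (Set.Iio_subset_Iio (h.2 hβ'))

/-! ### Countable abelian groups with deep elements -/

/-- The kernel of the map onto `A ⧸ zpowers z` is finite cyclic. -/
theorem IsReducedGroup.quotient_zpowers_pow {A : Type*} [CommGroup A] {z : A}
    (h : IsReducedGroup (A ⧸ Subgroup.zpowers z)) {n : ℕ} (hn : n ≠ 0) :
    IsReducedGroup (A ⧸ Subgroup.zpowers (z ^ n)) := by
  have hle : Subgroup.zpowers (z ^ n) ≤ (Subgroup.zpowers z).comap (MonoidHom.id A) := by
    rw [Subgroup.zpowers_le]
    exact Subgroup.pow_mem _ (Subgroup.mem_zpowers z) n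
  let f := QuotientGroup.map (Subgroup.zpowers (z ^ n)) (Subgroup.zpowers z) (MonoidHom.id A) hle
  let y : A ⧸ Subgroup.zpowers (z ^ n) := QuotientGroup.mk z
  have hker : f.ker ≤ Subgroup.zpowers y := by
    intro x hx
    obtain ⟨a, rfl⟩ := QuotientGroup.mk_surjective x
    obtain ⟨k, rfl⟩ := Subgroup.mem_zpowers_iff.1 ((QuotientGroup.eq_one_iff a).1 hx)
    exact Subgroup.mem_zpowers_iff.2 ⟨k, rfl⟩
  have hy : IsOfFinOrder y := isOfFinOrder_iff_pow_eq_one.2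
    ⟨n, Nat.pos_of_ne_zero hn, (QuotientGroup.eq_one_iff (z ^ n)).2 (Subgroup.mem_zpowers _)⟩
  have : Finite (Subgroup.zpowers y) := hy.finite_zpowers
  have : Finite f.ker := Finite.of_injective _ (Subgroup.inclusion_injective hker)
  exact h.of_hom_of_ker f isReducedGroup_of_finite

/-- The map `φ` forces `z` to have infinite order, so `A` is an extension of a reduced group by `ℤ`.
-/
theorem isReducedGroup_of_quotient_zpowers {A : Type*} [CommGroup A] {z : A}
    (h : IsReducedGroup (A ⧸ Subgroup.zpowers z)) (φ : A →* Multiplicative ℚ)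
    (hφ : φ z = Multiplicative.ofAdd 1) : IsReducedGroup A := by
  refine h.of_hom_of_ker (QuotientGroup.mk' _) ?_
  rw [QuotientGroup.ker_mk']
  have hinj : Injective fun k : ℤ ↦ z ^ k := fun k l hkl ↦ by
    have := congrArg (fun x ↦ Multiplicative.toAdd (φ x)) hkl
    simpa [hφ] using this
  have hord : ¬ IsOfFinOrder z := injective_zpow_iff_not_isOfFinOrder.1 hinj
  let e : Multiplicative ℤ →* Subgroup.zpowers z := zpowersHom _ ⟨z, Subgroup.mem_zpowers z⟩
  have he : Bijective e := by
    constructor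
    · intro k l hkl
      exact hinj (congrArg Subtype.val hkl)
    · rintro ⟨_, k, rfl⟩
      exact ⟨Multiplicative.ofAdd k, Subtype.ext rfl⟩
  exact isReducedGroup_multiplicative_int.of_injective (MulEquiv.ofBijective e he).symm.toMonoidHom
    (MulEquiv.injective _)

theorem countable_closure {G : Type*} [Group G] {S : Set G} (hS : S.Countable) :
    Countable (Subgroup.closure S) := by
  have := hS.to_subtype
  rw [FreeGroup.closure_eq_range]
  exact (MonoidHom.rangeRestrict_surjective _).countable

/-- The groups `A i` are glued along the `w i`, inside the product of the quotients with `ℚ`. The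
maps `φ i` supply the rational coordinate, which keeps the common image of the `w i` nontrivial. -/
theorem exists_amalgam {ι : Type} [Countable ι] (A : ι → Type) [∀ i, CommGroup (A i)]
    [∀ i, Countable (A i)] (w : ∀ i, A i) (φ : ∀ i, A i →* Multiplicative ℚ)
    (hφ : ∀ i, φ i (w i) = Multiplicative.ofAdd 1)
    (hred : ∀ i, IsReducedGroup (A i ⧸ Subgroup.zpowers (w i))) :
    ∃ (C : Type) (_ : CommGroup C) (z : C) (φ' : C →* Multiplicative ℚ) (ψ : ∀ i, A i →* C),
      Countable C ∧ φ' z = Multiplicative.ofAdd 1 ∧ IsReducedGroup (C ⧸ Subgroup.zpowers z) ∧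
      ∀ i, ψ i (w i) = z := by
  classical
  let Q := fun i ↦ A i ⧸ Subgroup.zpowers (w i)
  let e : Multiplicative ℚ := Multiplicative.ofAdd 1
  let ψ : ∀ i, A i →* (∀ i, Q i) × Multiplicative ℚ := fun i ↦
    ((MonoidHom.mulSingle Q i).comp (QuotientGroup.mk' _)).prod (φ i)
  let S : Set ((∀ i, Q i) × Multiplicative ℚ) := insert (1, e) (⋃ i, Set.range (ψ i))
  let C := Subgroup.closure S
  have hS : S.Countable := (Set.countable_iUnion fun i ↦ Set.countable_range (ψ i)).insert _
  have hle : ∀ i, Subgroup.zpowers (w i) ≤ (Subgroup.zpowers e).comap (φ i) := fun i ↦ by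
    rw [Subgroup.zpowers_le, Subgroup.mem_comap, hφ]
    exact Subgroup.mem_zpowers e
  let θ : ∀ i, Q i →* Multiplicative ℚ ⧸ Subgroup.zpowers e := fun i ↦
    QuotientGroup.map _ _ (φ i) (hle i)
  have hsupp : ∀ x : ∀ i, Q i, {i | x i ≠ 1}.Finite →
      (mulSupport fun i ↦ θ i (x i)).Finite := fun x hx ↦
    hx.subset fun i hi h1 ↦ hi ((congrArg (θ i) h1).trans (map_one _))
  -- On `C` the rational coordinate modulo `ℤ` is determined by the other coordinates. Hence the
  -- projections to the `Q i` separate the points of `C ⧸ zpowers z`.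
  have key : ∀ x ∈ C, {i | x.1 i ≠ 1}.Finite ∧
      (QuotientGroup.mk x.2 : Multiplicative ℚ ⧸ Subgroup.zpowers e) =
        ∏ᶠ i, θ i (x.1 i) := by
    intro x hx
    induction hx using Subgroup.closure_induction with
    | mem x hx =>
      rcases hx with rfl | hx
      · refine ⟨by simp, ?_⟩
        simp only [Pi.one_apply, map_one, finprod_one]
        exact (QuotientGroup.eq_one_iff e).2 (Subgroup.mem_zpowers e)
      · obtain ⟨i, a, rfl⟩ := Set.mem_iUnion.1 hx
        refine ⟨(Set.finite_singleton i).subset fun j hj ↦ by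
          by_contra h
          exact hj (Pi.mulSingle_eq_of_ne h _), ?_⟩
        rw [finprod_eq_single _ i fun j hj ↦ ?_]
        · change _ = θ i ((Pi.mulSingle i (QuotientGroup.mk a : Q i) : ∀ j, Q j) i)
          rw [Pi.mulSingle_eq_same]
          rfl
        · simp [ψ, Pi.mulSingle_eq_of_ne hj]
    | one => simp
    | mul x y _ _ hx hy =>
      refine ⟨(hx.1.union hy.1).subset fun i hi ↦ ?_, ?_⟩
      · by_contra h
        simp only [Set.mem_union, Set.mem_ofPred_eq, not_or, not_not] at h
        exact hi (by simp [h.1, h.2])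
      simp only [Prod.fst_mul, Prod.snd_mul, Pi.mul_apply, map_mul, QuotientGroup.mk_mul]
      rw [finprod_mul_distrib (hsupp _ hx.1) (hsupp _ hy.1), hx.2, hy.2]
    | inv x _ hx =>
      refine ⟨by simpa using hx.1, ?_⟩
      simp only [Prod.fst_inv, Prod.snd_inv, Pi.inv_apply, map_inv, QuotientGroup.mk_inv]
      rw [finprod_inv_distrib, hx.2]
  let z : C := ⟨(1, e), Subgroup.subset_closure (Set.mem_insert _ _)⟩
  have hmem : ∀ i a, ψ i a ∈ C := fun i a ↦ Subgroup.subset_closure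
    (Set.mem_insert_of_mem _ (Set.mem_iUnion.2 ⟨i, a, rfl⟩))
  refine ⟨C, inferInstance, z, (MonoidHom.snd _ _).comp C.subtype,
    fun i ↦ (ψ i).codRestrict C (hmem i), ?_, rfl, ?_, fun i ↦ ?_⟩
  · exact countable_closure hS
  · have hz : ∀ i, Subgroup.zpowers z ≤
        (((Pi.evalMonoidHom Q i).comp (MonoidHom.fst _ _)).comp C.subtype).ker := fun i ↦ by
      rw [Subgroup.zpowers_le]
      rfl
    let p : ∀ i, C ⧸ Subgroup.zpowers z →* Q i := fun i ↦ QuotientGroup.lift _ _ (hz i)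
    refine isReducedGroup_of_forall_hom fun K hK ↦ .inr ?_
    by_contra! hc
    refine hK ((Subgroup.eq_bot_iff_forall K).2 fun x hx ↦ ?_)
    obtain ⟨y, rfl⟩ := QuotientGroup.mk_surjective x
    have hy : y.1.1 = 1 := funext fun i ↦
      DFunLike.congr_fun (hc (Q i) _ ((p i).comp K.subtype) (hred i)) ⟨_, hx⟩
    have hy2 := (key y.1 y.2).2
    simp only [hy, Pi.one_apply, map_one, finprod_one] at hy2
    obtain ⟨k, hk⟩ := Subgroup.mem_zpowers_iff.1 ((QuotientGroup.eq_one_iff _).1 hy2)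
    refine (QuotientGroup.eq_one_iff _).2 (Subgroup.mem_zpowers_iff.2 ⟨k, Subtype.ext ?_⟩)
    refine Prod.ext ?_ hk
    simp [z, hy]
  · refine Subtype.ext (Prod.ext ?_ (hφ i))
    change (Pi.mulSingle i (QuotientGroup.mk (w i) : Q i) : ∀ j, Q j) = 1
    rw [(QuotientGroup.eq_one_iff _).2 (Subgroup.mem_zpowers (w i)), Pi.mulSingle_one]

/-- Identifying powers of deep elements for all `β < α` and all positive exponents gives one element
with roots of every order at every earlier depth. -/
theorem exists_isDeep (α : Ordinal.{v}) (hα : (Set.Iio α).Countable) :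
    ∃ (A : Type) (_ : CommGroup A) (z : A) (φ : A →* Multiplicative ℚ), Countable A ∧
      φ z = Multiplicative.ofAdd 1 ∧ IsReducedGroup (A ⧸ Subgroup.zpowers z) ∧ IsDeep z α := by
  induction α using WellFoundedLT.induction with
  | ind α ih =>
  have ih' : ∀ β : Set.Iio α, _ := fun β ↦
    ih β β.2 (hα.mono (Set.Iio_subset_Iio (le_of_lt β.2)))
  choose A hA z φ hc hφ hred hdeep using ih'
  have := hα.to_subtype
  let ι := Shrink.{0} (Set.Iio α) × ℕ
  let d : ι → Set.Iio α := fun i ↦ (equivShrink _).symm i.1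
  have : Countable (Shrink.{0} (Set.Iio α)) := Countable.of_equiv _ (equivShrink _)
  -- Dividing by `n + 1` makes the power `z ^ (n + 1)` take the value `1` again.
  let r : ℕ → Multiplicative ℚ →* Multiplicative ℚ := fun n ↦
    AddMonoidHom.toMultiplicative (AddMonoidHom.mulRight ((n + 1 : ℚ)⁻¹))
  obtain ⟨C, hC, w, φ', ψ, hcC, hφ', hredC, hψ⟩ := exists_amalgam (fun i : ι ↦ A (d i))
    (fun i ↦ z (d i) ^ (i.2 + 1)) (fun i ↦ (r i.2).comp (φ (d i))) (fun i ↦ by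
      have h0 : (i.2 + 1 : ℚ) ≠ 0 := by positivity
      rw [map_pow, MonoidHom.comp_apply, hφ]
      apply Multiplicative.toAdd.injective
      simp [r, h0])
    (fun i ↦ (hred (d i)).quotient_zpowers_pow (Nat.succ_ne_zero _))
  refine ⟨C, hC, w, φ', hcC, hφ', hredC, isDeep_of_forall_pow fun β hβ n hn ↦ ?_⟩
  let i : ι := (equivShrink _ ⟨β, hβ⟩, n - 1)
  have hi : d i = ⟨β, hβ⟩ := (equivShrink _).symm_apply_apply _
  refine ⟨ψ i (z (d i)), ?_, ?_⟩
  · have := hdeep (d i)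
    have h2 : ((d i : Set.Iio α) : Ordinal) = β := congrArg Subtype.val hi
    rw [h2] at this
    exact this.map _
  · rw [← hψ i, map_pow]
    congr 1
    simp only [i]
    omega

/-! ### Embedding countable groups into finitely generated groups -/

section Wreath

open RegularWreathProduct
open scoped commutatorElement

variable {D Q : Type*} [Group D] [Group Q]

/-- The inclusion of the base group of a wreath product. -/
def wreathBase : (Q → D) →* D ≀ᵣ Q where
  toFun p := ⟨p, 1⟩
  map_one' := rfl
  map_mul' p q := by ext <;> simp

theorem wreathBase_injective : Injective (wreathBase : (Q → D) →* D ≀ᵣ Q) := fun _ _ h ↦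
  congrArg RegularWreathProduct.left h

theorem inl_mul_wreathBase_mul_inv (q : Q) (p : Q → D) :
    (inl q : D ≀ᵣ Q) * wreathBase p * (inl q)⁻¹ = wreathBase fun x ↦ p (q⁻¹ * x) := by
  ext <;> simp [wreathBase]

/-- Evaluations at points of `Q` separate the base group, even though it is the full product. -/
theorem IsReducedGroup.wreath (hD : IsReducedGroup D) (hQ : IsReducedGroup Q) :
    IsReducedGroup (D ≀ᵣ Q) := by
  refine hQ.of_hom_of_ker rightHom (isReducedGroup_of_forall_hom fun K hK ↦ .inr ?_)
  by_contra! hc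
  refine hK ((Subgroup.eq_bot_iff_forall K).2 fun x hx ↦ Subtype.ext ?_)
  have hright : ∀ y : (rightHom : D ≀ᵣ Q →* Q).ker, y.1.right = 1 := fun y ↦ y.2
  let ev : Q → (rightHom : D ≀ᵣ Q →* Q).ker →* D := fun q ↦
    { toFun := fun y ↦ y.1.left q
      map_one' := rfl
      map_mul' := fun y y' ↦ by simp [hright y] }
  refine RegularWreathProduct.ext (funext fun q ↦ ?_) (hright x)
  exact DFunLike.congr_fun (hc D _ ((ev q).comp K.subtype) hD) ⟨x, hx⟩

/-- The step function with value `a` on the nonnegative integers. -/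
def wreathStep (a : D) : D ≀ᵣ Multiplicative ℤ :=
  wreathBase fun x ↦ if 0 ≤ Multiplicative.toAdd x then a else 1

theorem commutator_wreathStep_inl (a : D) :
    ⁅wreathStep a, (inl (Multiplicative.ofAdd 1) : D ≀ᵣ Multiplicative ℤ)⁆ =
      wreathBase (Pi.mulSingle 1 a) := by
  have h1 := inl_mul_wreathBase_mul_inv (Multiplicative.ofAdd (1 : ℤ))
    (fun x ↦ if 0 ≤ Multiplicative.toAdd x then a⁻¹ else 1)
  rw [commutatorElement_def, wreathStep, ← map_inv, mul_assoc, mul_assoc, ← mul_assoc (inl _)]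
  have h2 : (fun x : Multiplicative ℤ ↦ if 0 ≤ Multiplicative.toAdd x then a else 1)⁻¹ =
      fun x ↦ if 0 ≤ Multiplicative.toAdd x then a⁻¹ else 1 := by
    funext x
    by_cases hx : 0 ≤ Multiplicative.toAdd x <;> simp [hx]
  rw [h2, h1, ← map_mul]
  congr 1
  funext x
  obtain ⟨n, rfl⟩ := Multiplicative.ofAdd.surjective x
  have h3 : (Multiplicative.ofAdd (1 : ℤ))⁻¹ * Multiplicative.ofAdd n
    =
      Multiplicative.ofAdd (-1 + n) := rfl
  simp only [Pi.mul_apply, h3, toAdd_ofAdd]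
  rcases lt_trichotomy n 0 with hn | rfl | hn
  · rw [if_neg (by omega), if_neg (by omega), Pi.mulSingle_eq_of_ne]
    · simp
    · exact fun h ↦ hn.ne (Multiplicative.ofAdd.injective h)
  · rw [if_pos le_rfl, if_neg (by omega)]
    exact (mul_one a).trans (Pi.mulSingle_eq_same (M := fun _ : Multiplicative ℤ ↦ D) 1 a).symm
  · rw [if_pos hn.le, if_pos (by omega), Pi.mulSingle_eq_of_ne]
    · simp
    · exact fun h ↦ hn.ne' (Multiplicative.ofAdd.injective h)

/-- The function with value `t` at `0`, value `b i` at `2 * i + 1`, and trivial elsewhere. -/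
def sparseFun (t : D) (b : ℕ → D) (x : Multiplicative ℤ) : D :=
  if Multiplicative.toAdd x = 0 then t
  else if 0 < Multiplicative.toAdd x ∧ Odd (Multiplicative.toAdd x) then
    b (Multiplicative.toAdd x).toNat.div2
  else 1

/-- The support is `0` and positive odd numbers. An odd shift makes the two supports meet at most at
`0`, where the values are `b i` and `t`. -/
theorem commutator_shift_sparseFun (t : D) (b : ℕ → D) (i : ℕ) :
    (⁅fun x ↦ sparseFun t b (Multiplicative.ofAdd (2 * i + 1 : ℤ) * x), sparseFun t b⁆ :
      Multiplicative ℤ → D) = Pi.mulSingle 1 ⁅b i, t⁆ := by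
  funext x
  obtain ⟨n, rfl⟩ := Multiplicative.ofAdd.surjective x
  have h3 : Multiplicative.ofAdd (2 * i + 1 : ℤ) * Multiplicative.ofAdd n
    = Multiplicative.ofAdd (2 * i + 1 + n) := rfl
  have h4 : ∀ p q : Multiplicative ℤ → D, ⁅p, q⁆ = fun x ↦ ⁅p x, q x⁆ := fun _ _ ↦ rfl
  simp only [h4, sparseFun, h3, toAdd_ofAdd]
  by_cases hn : n = 0
  · subst hn
    have h5 : (2 * i + 1 + 0 : ℤ).toNat.div2 = i := by
      rw [Nat.div2_val]
      omega
    rw [if_pos rfl, if_neg (by omega), if_pos ⟨by omega, i, by ring⟩, h5]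
    exact (Pi.mulSingle_eq_same (M := fun _ : Multiplicative ℤ ↦ D) 1 ⁅b i, t⁆).symm
  · have h1 : Multiplicative.ofAdd n ≠ 1 := fun h ↦ hn (Multiplicative.ofAdd.injective h)
    rw [if_neg hn, Pi.mulSingle_eq_of_ne h1]
    by_cases ho : 0 < n ∧ Odd n
    · have h5 : ¬ Odd (2 * i + 1 + n : ℤ) := by
        obtain ⟨k, hk⟩ := ho.2
        rintro ⟨l, hl⟩
        omega
      rw [if_neg (by omega), if_neg fun h ↦ h5 h.2, commutatorElement_one_left]
    · rw [if_neg ho, commutatorElement_one_right]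

theorem exists_fg_embedding (A : Type) [Group A] [Countable A] (hA : IsReducedGroup A) :
    ∃ (G : Type) (_ : Group G) (f : A →* G), Group.FG G ∧ IsReducedGroup G ∧ Injective f := by
  obtain ⟨a, ha⟩ := exists_surjective_nat A
  let B := A ≀ᵣ Multiplicative ℤ
  let W := B ≀ᵣ Multiplicative ℤ
  let t : B := inl (Multiplicative.ofAdd 1)
  let g : W := wreathBase (sparseFun t fun i ↦ wreathStep (a i))
  let s : W := inl (Multiplicative.ofAdd 1)
  let G : Subgroup W := Subgroup.closure {g, s}
  have hg : g ∈ G := Subgroup.subset_closure (by simp)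
  have hs : s ∈ G := Subgroup.subset_closure (by simp)
  let f : A →* W := (wreathBase.comp (MonoidHom.mulSingle (fun _ ↦ B) 1)).comp
    (wreathBase.comp (MonoidHom.mulSingle (fun _ ↦ A) 1))
  have hf : Injective f := 
    (wreathBase_injective.comp (Pi.mulSingle_injective (M := fun _ ↦ B) 1)).comp
    (wreathBase_injective.comp (Pi.mulSingle_injective (M := fun _ ↦ A) 1))
  have hmem : ∀ x, f x ∈ G := by
    intro x
    obtain ⟨i, rfl⟩ := ha x
    -- The outer commutator isolates `⁅wreathStep (a i), t⁆` at one point, and this inner commutator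
    -- telescopes to `a i` at one point.
    have h1 : f (a i) = ⁅s ^ (-(2 * i + 1 : ℤ)) * g * (s ^ (-(2 * i + 1 : ℤ)))⁻¹, g⁆ := by
      have h2 : s ^ (-(2 * i + 1 : ℤ)) = inl (Multiplicative.ofAdd (2 * i + 1 : ℤ))⁻¹ := by
        rw [← map_zpow, ← ofAdd_zsmul]
        simp
      rw [h2, inl_mul_wreathBase_mul_inv, inv_inv, ← map_commutatorElement,
        commutator_shift_sparseFun, commutator_wreathStep_inl]
      rfl
    rw [h1, commutatorElement_def]
    have h3 : s ^ (-(2 * i + 1 : ℤ)) ∈ G := G.zpow_mem hs _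
    have h4 := G.mul_mem (G.mul_mem h3 hg) (G.inv_mem h3)
    exact G.mul_mem (G.mul_mem (G.mul_mem h4 hg) (G.inv_mem h4)) (G.inv_mem hg)
  refine ⟨G, inferInstance, f.codRestrict G hmem, ?_, ?_, fun x y h ↦ ?_⟩
  · exact (Group.fg_iff_subgroup_fg G).2
      ((Subgroup.fg_iff G).2 ⟨{g, s}, rfl, Set.toFinite _⟩)
  · exact ((hA.wreath isReducedGroup_multiplicative_int).wreath
      isReducedGroup_multiplicative_int).of_injective G.subtype G.subtype_injective
  · exact hf (congrArg Subtype.val h)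

end Wreath

/-! ### Counting depths -/

theorem countable_of_fg {G : Type*} [Group G] (h : Group.FG G) : Countable G := by
  obtain ⟨S, hS, hfin⟩ := Group.fg_iff.1 h
  have := countable_closure hfin.countable
  rw [hS] at this
  exact Subgroup.topEquiv.surjective.countable

theorem exists_fg_hasRFDepth_gt (α : Ordinal.{v}) (hα : (Set.Iio α).Countable) :
    ∃ (G : Type u) (_ : Group G) (δ : Ordinal.{v}), Group.FG G ∧ HasRFDepth G δ ∧ α < δ := by
  obtain ⟨A, _, z, φ, _, hφ, hred, hdeep⟩ := exists_isDeep α hα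
  obtain ⟨G, _, f, hfg, hG, hf⟩ :=
    exists_fg_embedding A (isReducedGroup_of_quotient_zpowers hred φ hφ)
  let e : G ≃* ULift.{u} G := MulEquiv.ulift.symm
  have hfg' : Group.FG (ULift.{u} G) := Group.fg_of_surjective (f := e.toMonoidHom) e.surjective
  have := countable_of_fg hfg'
  have hred' : IsReducedGroup (ULift.{u} G) :=
    hG.of_injective e.symm.toMonoidHom e.symm.injective
  obtain ⟨δ, hδ⟩ := exists_hasRFDepth.{u, v} hred'
  refine ⟨ULift.{u} G, inferInstance, δ, hfg', hδ, lt_of_hasRFDepth_of_isDeep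
    (hdeep.map (e.toMonoidHom.comp f)) (fun h ↦ ?_) hδ⟩
  have hz : z = 1 := (e.injective.comp hf) (h.trans (map_one (e.toMonoidHom.comp f)).symm)
  rw [hz, map_one] at hφ
  exact zero_ne_one (congrArg Multiplicative.toAdd hφ)

theorem not_countable_fg_depths :
    ¬ Set.Countable {α : Ordinal.{v} |
      ∃ (G : Type u) (_ : Group G), Group.FG G ∧ HasRFDepth G α} := by
  intro hc
  set D := {α : Ordinal.{v} | ∃ (G : Type u) (_ : Group G), Group.FG G ∧ HasRFDepth G α} with hD
  have hcount : (⋃ δ ∈ D, Set.Iio δ).Countable := hc.biUnion fun δ hδ ↦ by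
    obtain ⟨G, _, hG, hGδ⟩ := hδ
    have := countable_of_fg hG
    exact countable_Iio_of_hasRFDepth hGδ
  have hlow : IsLowerSet (⋃ δ ∈ D, Set.Iio δ) := by
    simp only [isLowerSet_iUnion₂, isLowerSet_Iio, implies_true]
  have hsub : {α : Ordinal.{v} | (Set.Iio α).Countable} ⊆ ⋃ δ ∈ D, Set.Iio δ := fun α hα ↦ by
    obtain ⟨G, i, δ, hG, hδ, hlt⟩ := exists_fg_hasRFDepth_gt.{u, v} α hα
    exact Set.mem_biUnion (show δ ∈ D from ⟨G, i, hG, hδ⟩) hlt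
  obtain ⟨α, hα⟩ : ∃ α : Ordinal.{v}, ¬ (Set.Iio α).Countable := by
    by_contra! h
    have := Set.countable_univ_iff.1 (hcount.mono fun α _ ↦ hsub (h α))
    obtain ⟨f, hf⟩ := exists_injective_nat Ordinal.{v}
    exact not_injective_of_ordinal f hf
  -- This `α` is the first uncountable ordinal; everything below it lies in the supposedly countable
  -- union.
  obtain ⟨α, hα, hmin⟩ := WellFounded.has_min (r := (· < · : Ordinal → Ordinal → Prop))
    Ordinal.lt_wf {α | ¬ (Set.Iio α).Countable} ⟨α, hα⟩
  exact hα (hcount.mono fun β hβ ↦ hsub (not_not.1 fun h ↦ hmin β h hβ))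

theorem IsOrdinalResiduallyFinite.of_injective {G : Type*} {G' : Type*} [Group G] [Group G']
    {α : Ordinal.{v}} (h : IsOrdinalResiduallyFinite G' α) (f : G →* G') (hf : Injective f) :
    IsOrdinalResiduallyFinite G α := by
  obtain ⟨H, hH, hbot⟩ := isOrdinalResiduallyFinite_iff.1 h
  refine isOrdinalResiduallyFinite_iff.2 ⟨_, hH.comap f, ?_⟩
  rw [hbot, MonoidHom.comap_bot, (MonoidHom.ker_eq_bot_iff f).2 hf]

theorem hasRFDepth_congr {G : Type*} {G' : Type*} [Group G] [Group G'] (e : G ≃* G')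
    {α : Ordinal.{v}} : HasRFDepth G α ↔ HasRFDepth G' α := by
  have : ∀ β : Ordinal.{v}, IsOrdinalResiduallyFinite G β ↔ IsOrdinalResiduallyFinite G' β :=
    fun β ↦ ⟨fun h ↦ IsOrdinalResiduallyFinite.of_injective h e.symm.toMonoidHom e.symm.injective,
      fun h ↦ IsOrdinalResiduallyFinite.of_injective h e.toMonoidHom e.injective⟩
  simp only [HasRFDepth, this]

theorem countable_fp_depths :
    Set.Countable {α : Ordinal.{v} |
      ∃ (G : Type u) (_ : Group G), Group.IsFinitelyPresented G ∧ HasRFDepth G α} := by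
  have : ∀ n, Countable (FreeGroup (Fin n)) := fun n ↦ countable_of_fg inferInstance
  refine (Set.countable_iUnion fun p : Σ n : ℕ, Finset (FreeGroup (Fin n)) ↦
    Set.Subsingleton.countable (s := {α : Ordinal.{v} |
      HasRFDepth (PresentedGroup (p.2 : Set (FreeGroup (Fin p.1)))) α})
      fun _ h _ h' ↦ h.unique h').mono ?_
  rintro α ⟨G, _, hG, hα⟩
  obtain ⟨n, s, hs, ⟨e⟩⟩ := Group.IsFinitelyPresented.exists_mulEquiv_presentedGroup (G := G)
  lift s to Finset (FreeGroup (Fin n)) using hs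
  exact Set.mem_iUnion.2 ⟨⟨n, s⟩, (hasRFDepth_congr e).1 hα⟩

end RFDepth

theorem corollaryC :
    ¬ Set.Countable {α : Ordinal.{v} |
      (∃ (G : Type u) (_ : Group G), Group.FG G ∧ HasRFDepth G α) ∧
      ¬ ∃ (G : Type u) (_ : Group G), Group.IsFinitelyPresented G ∧ HasRFDepth G α} := by
  intro h
  refine RFDepth.not_countable_fg_depths.{u, v}
    ((h.union RFDepth.countable_fp_depths.{u, v}).mono fun α hα ↦ ?_)
  by_cases hfp : ∃ (G : Type u) (_ : Group G), Group.IsFinitelyPresented G ∧ HasRFDepth G α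
  · exact .inr hfp
  · exact .inl ⟨hα, hfp⟩
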